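/- Let $d\ge 0$ and let $\rho$ be an irreducible complex representation of the symmetric group $S_d$ with character $\chi_\rho$; write $\chi_\rho(\alpha)$ for its value on permutations of cycle type $\alpha\vdash d$. Assume that $\rho$ is self-conjugate, i.e. $\rho\cong\rho\otimes\mathrm{sgn}$. For a partition $\beta=(1^{m_1}2^{m_2}\cdots)$ of $d$ with $\ell(\beta)$ parts, let $\zeta(\beta)=\prod_k m_k!\,k^{m_k}$, call $\beta$ odd if $d-\ell(\beta)$ is odd, and let $sq(\beta)$ be the partition of $d$ obtained from $\beta$ by splitting each even part into two equal parts. Put $$o(\rho)=\sum_{\beta\vdash d,\ \beta\ \mathrm{odd}}\frac{\chi_\rho(sq(\beta))}{\zeta(\beta)},\qquad \varepsilon_\rho=(-1)^{o(\rho)} .$$ Let $\mu$ be the Young diagram of $\rho$, i.e. the diagram with $d$ boxes such that $\rho$ is isomorphic to the left ideal $\mathbb{C}[S_d]\,c_T$ generated by the Young symmetrizer $c_T=a_Tb_T$ of a tableau $T$ on $\mu$ (a bijective filling of the boxes; $a_T$ is the sum of the permutations preserving the rows of $T$, and $b_T$ is the sum of $\mathrm{sgn}(g)\,g$ over the permutations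 $g$ preserving the columns). Let $r(\rho)$ be the length of the main diagonal of $\mu$. Then $o(\rho)\in\{0,1\}$, $d-r(\rho)$ is a nonnegative even integer, and $$\varepsilon_\rho=(-1)^{\frac{d-r(\rho)}{2}} .$$ -/

import Mathlib

/-!
# Irreducible representations of symmetric groups, their Young diagrams and the sign `ε_ρ`

`S_d` is `Equiv.Perm (Fin d)`; representations are over `ℂ`.
-/

namespace SymRep

noncomputable section

/-! ## Partitions -/

/-- `ζ(λ) = ∏ m_k! k^{m_k}`, where `m_k` is the number of parts of `λ` equal to `k`. -/
def zeta {d : ℕ} (p : Nat.Partition d) : ℕ :=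
  ∏ k ∈ p.parts.toFinset, (p.parts.count k).factorial * k ^ p.parts.count k

/-- The splitting rule for a single part: an even part is replaced by two equal halves, an odd part
is kept. -/
def splitPart (k : ℕ) : Multiset ℕ := if Even k then {k / 2, k / 2} else {k}

lemma splitPart_sum (k : ℕ) : (splitPart k).sum = k := by
  unfold splitPart
  split_ifs with h
  · obtain ⟨m, rfl⟩ := h
    simp
    omega
  · simp

lemma pos_of_mem_splitPart {k i : ℕ} (hk : 0 < k) (hi : i ∈ splitPart k) : 0 < i := by
  unfold splitPart at hi
  split_ifs at hi with h
  · obtain ⟨m, rfl⟩ := h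
    simp at hi
    omega
  · simp at hi
    omega

/-- `sq(λ)`: the partition obtained from `λ` by splitting each even part into two equal parts. -/
def sq {d : ℕ} (p : Nat.Partition d) : Nat.Partition d where
  parts := p.parts.bind splitPart
  parts_pos := by
    intro i hi
    obtain ⟨k, hk, hik⟩ := Multiset.mem_bind.1 hi
    exact pos_of_mem_splitPart (p.parts_pos hk) hik
  parts_sum := by
    rw [Multiset.sum_bind]
    simp only [splitPart_sum, Multiset.map_id']
    exact p.parts_sum

/-- A partition `λ` of `d` is odd if `d - ℓ(λ)` is odd, i.e. if the permutations of cycle type `λ`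
are odd. -/
def IsOddPartition {d : ℕ} (p : Nat.Partition d) : Prop := Odd (d - Multiset.card p.parts)

/-- Every partition of `d` is the cycle type (fixed points counted as parts `1`) of some
permutation. -/
lemma exists_perm_of_partition {d : ℕ} (p : Nat.Partition d) :
    ∃ g : Equiv.Perm (Fin d), g.partition.parts = p.parts := by
  classical
  have hsplit : p.parts.filter (2 ≤ ·) + p.parts.filter (fun i => ¬ 2 ≤ i) = p.parts :=
    Multiset.filter_add_not _ _
  have hone : p.parts.filter (fun i => ¬ 2 ≤ i)
      = Multiset.replicate (Multiset.card (p.parts.filter (fun i => ¬ 2 ≤ i))) 1 := by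
    rw [Multiset.eq_replicate]
    refine ⟨rfl, fun b hb => ?_⟩
    rw [Multiset.mem_filter] at hb
    have := p.parts_pos hb.1
    omega
  have hsum : (p.parts.filter (2 ≤ ·)).sum
      + Multiset.card (p.parts.filter (fun i => ¬ 2 ≤ i)) = d := by
    have h := congrArg Multiset.sum hsplit
    rw [Multiset.sum_add, hone, Multiset.sum_replicate, p.parts_sum] at h
    simpa using h
  obtain ⟨g, hg⟩ := (Equiv.Perm.exists_with_cycleType_iff (Fin d)
    (m := p.parts.filter (2 ≤ ·))).2
    ⟨by rw [Fintype.card_fin]; omega, fun a ha => (Multiset.mem_filter.1 ha).2⟩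
  refine ⟨g, ?_⟩
  rw [Equiv.Perm.parts_partition, ← Equiv.Perm.sum_cycleType, hg, Fintype.card_fin]
  have : d - (p.parts.filter (2 ≤ ·)).sum
      = Multiset.card (p.parts.filter (fun i => ¬ 2 ≤ i)) := by omega
  rw [this, ← hone, hsplit]

/-- A permutation of cycle type `p`. -/
def permOfPartition {d : ℕ} (p : Nat.Partition d) : Equiv.Perm (Fin d) :=
  (exists_perm_of_partition p).choose

lemma permOfPartition_spec {d : ℕ} (p : Nat.Partition d) :
    (permOfPartition p).partition.parts = p.parts :=
  (exists_perm_of_partition p).choose_spec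

/-! ## Characters and the sign `ε_ρ` -/

section Representations

variable {d : ℕ} {V : Type*} [AddCommGroup V] [Module ℂ V]

/-- `χ_ρ(α)`: the trace of `ρ` on the conjugacy class of permutations of cycle type `α`. -/
def characterAt (ρ : Representation ℂ (Equiv.Perm (Fin d)) V) (p : Nat.Partition d) : ℂ :=
  ρ.character (permOfPartition p)

open Classical in
/-- `o(ρ) = ∑ χ_ρ(sq(β)) / ζ(β)`, the sum over the odd partitions `β` of `d`. -/
def o (ρ : Representation ℂ (Equiv.Perm (Fin d)) V) : ℂ :=
  ∑ p : Nat.Partition d with IsOddPartition p, characterAt ρ (sq p) / (zeta p : ℂ)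

/-- `ε_ρ = (-1)^{o(ρ)}`. -/
def epsilon (ρ : Representation ℂ (Equiv.Perm (Fin d)) V) : ℂ := (-1) ^ o ρ

/-- The conjugate representation `ρ' = ρ ⊗ sgn`, realised on the space of `ρ`. -/
def conjugate (ρ : Representation ℂ (Equiv.Perm (Fin d)) V) :
    Representation ℂ (Equiv.Perm (Fin d)) V where
  toFun g := ((Equiv.Perm.sign g : ℤ) : ℂ) • ρ g
  map_one' := by simp
  map_mul' g h := by
    rw [map_mul, map_mul, smul_mul_smul_comm]
    push_cast
    rfl

/-- `ρ` is self-conjugate if it is isomorphic to its conjugate. -/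
def IsSelfConjugate (ρ : Representation ℂ (Equiv.Perm (Fin d)) V) : Prop :=
  Nonempty (ρ.Equiv (conjugate ρ))

end Representations

/-! ## The Young diagram of an irreducible representation -/

section Young

variable {d : ℕ} {μ : YoungDiagram}

open Classical in
/-- The row sum `a_T = ∑ g` over the permutations `g` preserving each row of the tableau `T`
(a bijective filling of the boxes of `μ` by `Fin d`; the box `(i, j)` lies in row `i`). -/
def rowSum (T : μ.cells ≃ Fin d) : MonoidAlgebra ℂ (Equiv.Perm (Fin d)) :=
  ∑ g : Equiv.Perm (Fin d) with ∀ x, (T.symm (g x)).1.1 = (T.symm x).1.1,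
    MonoidAlgebra.single g 1

open Classical in
/-- The signed column sum `b_T = ∑ sgn(g) g` over the permutations `g` preserving each column
of `T`. -/
def colSum (T : μ.cells ≃ Fin d) : MonoidAlgebra ℂ (Equiv.Perm (Fin d)) :=
  ∑ g : Equiv.Perm (Fin d) with ∀ x, (T.symm (g x)).1.2 = (T.symm x).1.2,
    MonoidAlgebra.single g ((Equiv.Perm.sign g : ℤ) : ℂ)

/-- The Young symmetrizer `c_T = a_T b_T`. -/
def youngSymmetrizer (T : μ.cells ≃ Fin d) : MonoidAlgebra ℂ (Equiv.Perm (Fin d)) :=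
  rowSum T * colSum T

/-- The irreducible `ℂ[S_d]`-module attached to (a tableau on) `μ`: the left ideal generated by the
Young symmetrizer. -/
def youngModule (T : μ.cells ≃ Fin d) : Ideal (MonoidAlgebra ℂ (Equiv.Perm (Fin d))) :=
  Ideal.span {youngSymmetrizer T}

/-- `μ` is the Young diagram of the representation `ρ` of `S_d`: `μ` has `d` boxes and `ρ` is
isomorphic to the left ideal `ℂ[S_d] c_T`, `T` a tableau on `μ` (up to isomorphism this ideal does
not depend on `T`). -/
def HasYoungDiagram {V : Type*} [AddCommGroup V] [Module ℂ V]
    (ρ : Representation ℂ (Equiv.Perm (Fin d)) V) (μ : YoungDiagram) : Prop :=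
  ∃ T : μ.cells ≃ Fin d,
    Nonempty (ρ.asModule ≃ₗ[MonoidAlgebra ℂ (Equiv.Perm (Fin d))] youngModule T)

/-- The rank `r(μ)`: the length of the main diagonal of `μ`. -/
def rank (μ : YoungDiagram) : ℕ := (μ.cells.filter fun c => c.1 = c.2).card

end Young

end

end SymRep

/-! There are `d! / ζ(β)` permutations of cycle type `β`, and their squares have cycle type `sq β`.
So `d! · o(ρ)` is the sum of `χ_ρ(g²)` over odd `g`, and `2 o(ρ)` is the Frobenius–Schur indicator
of `ρ` minus its twist by `sgn`. By `sum_character_sq`, such an indicator is the symmetry sign of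
any nonzero form that is invariant up to the character.

Such forms exist explicitly on `ℂ[G] c_T`. With `†` the anti-automorphism `g ↦ χ(g) g⁻¹`, take `(x,
y) ↦ [w](x† y)` for an involution `w` (or `w = 1`); its symmetry sign is `χ(w)`. For `χ = 1`, `w =
1` this gives indicator `1`. For `χ = sgn`, let `w` reflect the tableau in its diagonal: then `c_T†
= w c_T w`, and the form is nonzero because `c_T² ≠ 0`. As `w` fixes exactly the `r` diagonal
entries, its sign is `(-1)^((d-r)/2)`, whence `2 o(ρ) = 1 - (-1)^((d-r)/2)`.

The reflection needs `μ` to be symmetric. This is deduced from `ρ ≅ ρ ⊗ sgn` in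
`swap_mem_of_isSelfConjugate`, by comparing `μ` with its transpose in the dominance order in both
directions. -/

namespace SymRep

/-! ### Cycle types of squares, and `o(ρ)` as a sum over odd permutations -/

open Equiv Equiv.Perm in
lemma cycleType_sq_of_isCycle {α : Type*} [Fintype α] [DecidableEq α] {σ : Perm α}
    (hσ : σ.IsCycle) :
    (σ ^ 2).cycleType = (splitPart (orderOf σ)).filter (2 ≤ ·) := by
  by_cases he : Even (orderOf σ)
  · obtain ⟨m, hm⟩ := he
    have hcard : σ.support.card = m + m := by rw [← hσ.orderOf, hm]
    have hm0 : 0 < m := by have := hσ.two_le_card_support; omega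
    have hsplit : splitPart (orderOf σ) = {m, m} := by
      rw [splitPart, if_pos ⟨m, hm⟩]
      congr 1 <;> [skip; congr 1] <;> omega
    rw [hsplit]
    rcases Nat.lt_or_ge m 2 with h | h
    -- A transposition squares to the identity, and both halves `1` are discarded by the filter.
    · have h1 : m = 1 := by omega
      subst h1
      have : σ ^ 2 = 1 := by
        have := pow_orderOf_eq_one σ
        rwa [hm] at this
      rw [this]
      simp
      decide
    · have hall : ∀ n ∈ (σ ^ 2).cycleType, n = m := by
        intro n hn
        -- A cycle of `σ ^ 2` of length `n` has `n ∣ m` since `(σ ^ 2) ^ m = 1`. Conversely `σ ^ (2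
        -- * n)` fixes a point moved by the cycle `σ`, so it is `1` and `2 * m ∣ 2 * n`.
        apply Nat.dvd_antisymm
        · refine (dvd_of_mem_cycleType hn).trans (orderOf_dvd_of_pow_eq_one ?_)
          rw [← pow_mul, two_mul, ← hm, pow_orderOf_eq_one]
        · rw [cycleType_def, Multiset.mem_map] at hn
          obtain ⟨c, hc, rfl⟩ := hn
          have hc' := mem_cycleFactorsFinset_iff.1 hc
          obtain ⟨x, hx⟩ := hc'.1.nonempty_support
          have hk : ∀ k : ℕ, ((σ ^ 2) ^ k) x = (c ^ k) x ∧ (c ^ k) x ∈ c.support := by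
            intro k
            induction k with
            | zero => simpa using hx
            | succ k ih =>
              refine ⟨?_, ?_⟩
              · rw [pow_succ' (σ ^ 2) k, pow_succ' c k, Perm.mul_apply, Perm.mul_apply, ih.1, hc'.2 _ ih.2]
              · exact (pow_apply_mem_support (n := k + 1)).2 hx
          have hx2 := (hk c.support.card).1
          rw [← hc'.1.orderOf, pow_orderOf_eq_one, one_apply, ← pow_mul] at hx2
          have hxσ : σ x ≠ x := by
            have h1 : x ∈ (σ ^ 2).support := mem_cycleFactorsFinset_support_le hc hx
            exact mem_support.1 (support_pow_le σ 2 h1)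
          have h1 : σ ^ (2 * orderOf c) = 1 := hσ.pow_eq_one_iff.2 ⟨x, hxσ, hx2⟩
          have h2 := orderOf_dvd_of_pow_eq_one h1
          rw [hm, ← two_mul, hc'.1.orderOf] at h2
          exact Nat.dvd_of_mul_dvd_mul_left (by norm_num) h2
      have hrep := Multiset.eq_replicate_of_mem hall
      have hsum := sum_cycleType (σ ^ 2)
      rw [hσ.support_pow_of_pos_of_lt_orderOf (by norm_num) (by omega), hcard, hrep,
        Multiset.sum_replicate, smul_eq_mul] at hsum
      have hc2 : (σ ^ 2).cycleType.card = 2 := by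
        rw [← two_mul] at hsum
        exact Nat.eq_of_mul_eq_mul_right hm0 hsum
      rw [hrep, hc2, Multiset.filter_eq_self.2]
      · rfl
      · intro a ha
        simp at ha
        omega
  · have hodd := Nat.not_even_iff_odd.1 he
    have hcop : Nat.Coprime 2 (orderOf σ) := (Nat.coprime_two_left).2 hodd
    have hcyc := hσ.pow_iff.2 hcop
    rw [hcyc.cycleType, support_pow_coprime hcop, splitPart, if_neg he, ← hσ.orderOf,
      Multiset.filter_eq_self.2]
    · intro a ha
      rw [Multiset.mem_singleton.1 ha, hσ.orderOf]
      exact hσ.two_le_card_support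

open Equiv Equiv.Perm in
lemma cycleType_sq {α : Type*} [Fintype α] [DecidableEq α] (σ : Perm α) :
    (σ ^ 2).cycleType = (σ.cycleType.bind splitPart).filter (2 ≤ ·) := by
  induction σ using cycle_induction_on with
  | base_one => simp
  | base_cycles σ hσ =>
    rw [cycleType_sq_of_isCycle hσ, hσ.cycleType, hσ.orderOf]
    simp
  | induction_disjoint σ τ hd hσ h1 h2 =>
    rw [hd.commute.mul_pow, Disjoint.cycleType_mul (hd.pow_disjoint_pow 2 2), h1, h2,
      hd.cycleType_mul, Multiset.add_bind, Multiset.filter_add]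

/-- Parts `1` are determined by the other parts, which allows passage to `cycleType`, where fixed
points are not recorded. -/
lemma parts_eq_filter_add_replicate {d : ℕ} (p : Nat.Partition d) :
    p.parts = p.parts.filter (2 ≤ ·)
      + Multiset.replicate (d - (p.parts.filter (2 ≤ ·)).sum) 1 := by
  obtain ⟨g, hg⟩ := exists_perm_of_partition p
  rw [← hg, Equiv.Perm.filter_parts_partition_eq_cycleType, Equiv.Perm.parts_partition,
    ← Equiv.Perm.sum_cycleType, Fintype.card_fin]

lemma parts_eq_iff_filter_eq {d : ℕ} (p q : Nat.Partition d) :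
    p.parts.filter (2 ≤ ·) = q.parts.filter (2 ≤ ·) ↔ p = q := by
  refine ⟨fun h => Nat.Partition.ext ?_, fun h => h ▸ rfl⟩
  rw [parts_eq_filter_add_replicate p, parts_eq_filter_add_replicate q, h]

/-- The cycle type of a permutation, as a partition of `d`. -/
def cyclePartition {d : ℕ} (g : Equiv.Perm (Fin d)) : Nat.Partition d where
  parts := g.partition.parts
  parts_pos := g.partition.parts_pos
  parts_sum := by rw [g.partition.parts_sum, Fintype.card_fin]

lemma filter_cyclePartition {d : ℕ} (g : Equiv.Perm (Fin d)) :
    (cyclePartition g).parts.filter (2 ≤ ·) = g.cycleType :=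
  Equiv.Perm.filter_parts_partition_eq_cycleType

lemma cyclePartition_permOfPartition {d : ℕ} (p : Nat.Partition d) :
    cyclePartition (permOfPartition p) = p :=
  Nat.Partition.ext (permOfPartition_spec p)

lemma cyclePartition_sq {d : ℕ} (g : Equiv.Perm (Fin d)) :
    cyclePartition (g ^ 2) = sq (cyclePartition g) := by
  rw [← parts_eq_iff_filter_eq, filter_cyclePartition, cycleType_sq]
  change _ = ((cyclePartition g).parts.bind splitPart).filter (2 ≤ ·)
  rw [parts_eq_filter_add_replicate (cyclePartition g), filter_cyclePartition, Multiset.add_bind,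
    Multiset.filter_add, left_eq_add, Multiset.filter_eq_nil]
  intro a ha
  obtain ⟨k, hk, hak⟩ := Multiset.mem_bind.1 ha
  rw [Multiset.eq_of_mem_replicate hk, splitPart, if_neg (by decide)] at hak
  rw [Multiset.mem_singleton.1 hak]
  decide

lemma isConj_iff_cyclePartition_eq {d : ℕ} (g h : Equiv.Perm (Fin d)) :
    IsConj g h ↔ cyclePartition g = cyclePartition h := by
  rw [Equiv.Perm.isConj_iff_cycleType_eq, ← parts_eq_iff_filter_eq, filter_cyclePartition,
    filter_cyclePartition]

/-- A fixed point adds one both to `d` and to the number of parts, so only the nontrivial cycles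
count. -/
lemma isOddPartition_cyclePartition_iff {d : ℕ} (g : Equiv.Perm (Fin d)) :
    IsOddPartition (cyclePartition g) ↔ Equiv.Perm.sign g = -1 := by
  have hle : g.support.card ≤ d := by simpa using g.support.card_le_univ
  have hcard : d - Multiset.card (cyclePartition g).parts
      = g.support.card - Multiset.card g.cycleType := by
    change d - Multiset.card g.partition.parts = _
    rw [Equiv.Perm.parts_partition, Multiset.card_add, Multiset.card_replicate, Fintype.card_fin]
    omega
  have hle2 : Multiset.card g.cycleType ≤ g.support.card := by
    rw [← Equiv.Perm.sum_cycleType]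
    simpa using Multiset.card_nsmul_le_sum
      (fun x hx => (Equiv.Perm.one_lt_of_mem_cycleType hx).le)
  rw [IsOddPartition, hcard, Equiv.Perm.sign_of_cycleType, Equiv.Perm.sum_cycleType,
    neg_one_pow_eq_neg_one_iff_odd (by decide), Nat.odd_sub hle2, Nat.odd_add]

/-- The part `1`, of multiplicity `r`, contributes `r! * 1 ^ r`; separating it matches the count in
`Equiv.Perm.card_of_cycleType_mul_eq`. -/
lemma zeta_eq {d : ℕ} (p : Nat.Partition d) :
    zeta p = (d - (p.parts.filter (2 ≤ ·)).sum).factorial * (p.parts.filter (2 ≤ ·)).prod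
      * ∏ n ∈ (p.parts.filter (2 ≤ ·)).toFinset,
        ((p.parts.filter (2 ≤ ·)).count n).factorial := by
  set m := p.parts.filter (2 ≤ ·) with hm
  have hp := parts_eq_filter_add_replicate p
  rw [← hm] at hp
  set r := d - m.sum
  have h1m : 1 ∉ m := fun h => by
    have := (Multiset.mem_filter.1 h).2
    omega
  rw [zeta, Finset.prod_mul_distrib, ← Finset.prod_multiset_count]
  have hprod : p.parts.prod = m.prod := by
    rw [hp, Multiset.prod_add, Multiset.prod_replicate, one_pow, mul_one]
  have hfac : ∏ k ∈ p.parts.toFinset, (p.parts.count k).factorial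
      = r.factorial * ∏ n ∈ m.toFinset, (m.count n).factorial := by
    have hsub : p.parts.toFinset ⊆ insert 1 m.toFinset := by
      intro x hx
      rw [hp, Multiset.mem_toFinset, Multiset.mem_add] at hx
      rcases hx with hx | hx
      · exact Finset.mem_insert_of_mem (Multiset.mem_toFinset.2 hx)
      · rw [Multiset.eq_of_mem_replicate hx]
        exact Finset.mem_insert_self _ _
    rw [Finset.prod_subset hsub, Finset.prod_insert (by simpa using h1m)]
    · congr 1
      · rw [hp, Multiset.count_add, Multiset.count_eq_zero_of_notMem h1m,
          Multiset.count_replicate_self, zero_add]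
      · refine Finset.prod_congr rfl fun n hn => ?_
        have : n ≠ 1 := fun h => h1m (h ▸ Multiset.mem_toFinset.1 hn)
        rw [hp, Multiset.count_add, Multiset.count_replicate, if_neg (Ne.symm this), add_zero]
    · intro x _ hx
      rw [Multiset.count_eq_zero_of_notMem (by simpa using hx), Nat.factorial_zero]
  rw [hprod, hfac]
  ring

lemma card_cyclePartition_mul_zeta {d : ℕ} (p : Nat.Partition d) :
    Finset.card {g : Equiv.Perm (Fin d) | cyclePartition g = p} * zeta p = d.factorial := by
  have h := Equiv.Perm.card_of_cycleType_mul_eq (Fin d) (p.parts.filter (2 ≤ ·))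
  have hle : (p.parts.filter (2 ≤ ·)).sum ≤ d := by
    have := congrArg Multiset.sum (parts_eq_filter_add_replicate p)
    rw [Multiset.sum_add, p.parts_sum] at this
    omega
  rw [if_pos ⟨by simpa using hle, fun a ha => (Multiset.mem_filter.1 ha).2⟩, Fintype.card_fin,
    ← zeta_eq] at h
  rw [← h]
  congr 2
  ext g
  simp only [Finset.mem_filter, Finset.mem_univ, true_and]
  rw [← parts_eq_iff_filter_eq, filter_cyclePartition]

lemma characterAt_cyclePartition {d : ℕ} {V : Type*} [AddCommGroup V] [Module ℂ V]
    (ρ : Representation ℂ (Equiv.Perm (Fin d)) V) (g : Equiv.Perm (Fin d)) :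
    characterAt ρ (cyclePartition g) = ρ.character g := by
  have : IsConj g (permOfPartition (cyclePartition g)) := by
    rw [isConj_iff_cyclePartition_eq, cyclePartition_permOfPartition]
  obtain ⟨c, hc⟩ := isConj_iff.1 this
  rw [characterAt, ← hc, Representation.char_conj]

/-- `o(ρ)` as an average over the odd permutations. -/
lemma factorial_mul_o {d : ℕ} {V : Type*} [AddCommGroup V] [Module ℂ V]
    (ρ : Representation ℂ (Equiv.Perm (Fin d)) V) :
    (d.factorial : ℂ) * o ρ
      = ∑ g : Equiv.Perm (Fin d) with Equiv.Perm.sign g = -1, ρ.character (g ^ 2) := by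
  classical
  rw [o, Finset.mul_sum]
  rw [← Finset.sum_fiberwise_of_maps_to (s := {g : Equiv.Perm (Fin d) | Equiv.Perm.sign g = -1})
    (t := {p : Nat.Partition d | IsOddPartition p}) (g := cyclePartition)
    (fun g hg => by simpa [isOddPartition_cyclePartition_iff] using hg)]
  refine Finset.sum_congr rfl fun p hp => ?_
  rw [Finset.mem_filter] at hp
  have hz : (zeta p : ℂ) ≠ 0 := by
    intro h
    have h1 := card_cyclePartition_mul_zeta p
    rw [Nat.cast_eq_zero.1 h, mul_zero] at h1
    exact d.factorial_ne_zero h1.symm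
  have hfilter : ({g ∈ ({g : Equiv.Perm (Fin d) | Equiv.Perm.sign g = -1} : Finset _) |
      cyclePartition g = p}) = ({g | cyclePartition g = p} : Finset _) := by
    ext g
    simp only [Finset.mem_filter, Finset.mem_univ, true_and, and_iff_right_iff_imp]
    rintro rfl
    exact (isOddPartition_cyclePartition_iff g).1 hp.2
  rw [hfilter, Finset.sum_congr rfl (g := fun _ => characterAt ρ (sq p)), Finset.sum_const,
    nsmul_eq_mul, ← card_cyclePartition_mul_zeta p]
  · push_cast
    field_simp
  · intro g hg
    rw [← (Finset.mem_filter.1 hg).2, ← cyclePartition_sq, characterAt_cyclePartition]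

end SymRep

/-! ### Semi-invariant forms and the twisted Frobenius–Schur indicator -/

namespace SymRep

section FrobeniusSchur

variable {G : Type*} [Group G] {V : Type*} [AddCommGroup V] [Module ℂ V]

/-- A submodule stable under an irreducible representation is trivial. -/
lemma eq_bot_or_eq_top_of_forall_mem (ρ : Representation ℂ G V) (hirr : ρ.IsIrreducible)
    (W : Submodule ℂ V) (hW : ∀ g, ∀ v ∈ W, ρ g v ∈ W) : W = ⊥ ∨ W = ⊤ := by
  let S : Subrepresentation ρ := ⟨W, fun g v hv => hW g v hv⟩
  rcases hirr.eq_bot_or_eq_top S with h | h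
  · exact Or.inl (congrArg Subrepresentation.toSubmodule h)
  · exact Or.inr (congrArg Subrepresentation.toSubmodule h)

/-- A form on a representation which is invariant up to the linear character `χ`. -/
def IsSemiInvariant (ρ : Representation ℂ G V) (χ : G →* ℂˣ) (B : V →ₗ[ℂ] V →ₗ[ℂ] ℂ) : Prop :=
  ∀ g v w, B (ρ g v) (ρ g w) = (χ g : ℂ) * B v w

variable {ρ : Representation ℂ G V} {χ : G →* ℂˣ} {B C : V →ₗ[ℂ] V →ₗ[ℂ] ℂ}

lemma IsSemiInvariant.sub_smul (hB : IsSemiInvariant ρ χ B) (hC : IsSemiInvariant ρ χ C) (c : ℂ) :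
    IsSemiInvariant ρ χ (C - c • B) := by
  intro g v w
  simp only [LinearMap.sub_apply, LinearMap.smul_apply, smul_eq_mul, hB g v w, hC g v w]
  ring

lemma IsSemiInvariant.ker_eq_bot_or_eq_zero (hirr : ρ.IsIrreducible)
    (hB : IsSemiInvariant ρ χ B) : LinearMap.ker B = ⊥ ∨ B = 0 := by
  rw [← LinearMap.ker_eq_top]
  refine eq_bot_or_eq_top_of_forall_mem ρ hirr _ fun g v hv => ?_
  rw [LinearMap.mem_ker] at hv ⊢
  ext w
  have h := hB g v (ρ g⁻¹ w)
  rw [hv, ← Module.End.mul_apply, ← map_mul, mul_inv_cancel, map_one] at h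
  simpa using h

/-- Schur's lemma for semi-invariant forms. -/
lemma IsSemiInvariant.exists_eq_smul [FiniteDimensional ℂ V] (hirr : ρ.IsIrreducible)
    (hB : IsSemiInvariant ρ χ B) (hB0 : B ≠ 0) (hC : IsSemiInvariant ρ χ C) :
    ∃ c : ℂ, C = c • B := by
  have hker := (hB.ker_eq_bot_or_eq_zero hirr).resolve_right hB0
  have hinj : Function.Injective B := LinearMap.ker_eq_bot.1 hker
  let e : V ≃ₗ[ℂ] Module.Dual ℂ V :=
    LinearEquiv.ofInjectiveOfFinrankEq B hinj (Subspace.dual_finrank_eq).symm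
  have he : ∀ v, e v = B v := fun v => rfl
  have hnt : Nontrivial V := by
    by_contra h
    rw [not_nontrivial_iff_subsingleton] at h
    exact hB0 (LinearMap.ext fun v => by rw [Subsingleton.elim v 0]; simp)
  -- An eigenvector of `B⁻¹ C` with eigenvalue `c` lies in the kernel of the semi-invariant form `C
  -- - c • B`, which must then vanish.
  obtain ⟨c, hc⟩ := Module.End.exists_eigenvalue (e.symm.toLinearMap ∘ₗ C)
  obtain ⟨v, hv⟩ := hc.exists_hasEigenvector
  refine ⟨c, ?_⟩
  have hCv : C v = c • B v := by
    have h : e.symm (C v) = c • v := hv.apply_eq_smul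
    rw [LinearEquiv.symm_apply_eq] at h
    rw [h, map_smul, he]
  have h := (hB.sub_smul hC c).ker_eq_bot_or_eq_zero hirr
  rcases h with h | h
  · refine absurd ?_ hv.2
    rw [← Submodule.mem_bot ℂ, ← h, LinearMap.mem_ker, LinearMap.sub_apply, LinearMap.smul_apply,
      hCv, sub_self]
  · exact sub_eq_zero.1 h

/-- The average of a form over a finite group, weighted by a linear character. -/
noncomputable def average [Fintype G] (ρ : Representation ℂ G V) (χ : G →* ℂˣ)
    (B : V →ₗ[ℂ] V →ₗ[ℂ] ℂ) : V →ₗ[ℂ] V →ₗ[ℂ] ℂ :=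
  ∑ g, ((χ g)⁻¹ : ℂˣ).val • B.compl₁₂ (ρ g) (ρ g)

lemma average_apply [Fintype G] (v w : V) :
    average ρ χ B v w = ∑ g, ((χ g)⁻¹ : ℂˣ).val * B (ρ g v) (ρ g w) := by
  simp [average, LinearMap.sum_apply]

lemma isSemiInvariant_average [Fintype G] : IsSemiInvariant ρ χ (average ρ χ B) := by
  intro h v w
  rw [average_apply, average_apply, Finset.mul_sum]
  refine Fintype.sum_equiv (Equiv.mulRight h) _ _ fun g => ?_
  simp only [Equiv.coe_mulRight, map_mul, Module.End.mul_apply, mul_inv, Units.val_mul]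
  rw [← mul_assoc, mul_left_comm, Units.mul_inv, mul_one]

/-- The twisted Frobenius–Schur indicator is the symmetry sign of a semi-invariant form. -/
theorem sum_character_sq [Fintype G] [FiniteDimensional ℂ V] (hirr : ρ.IsIrreducible)
    (hB : IsSemiInvariant ρ χ B) (hB0 : B ≠ 0) (s : ℂ) (hs : ∀ v w, B w v = s * B v w) :
    ∑ g, ((χ g)⁻¹ : ℂˣ).val * ρ.character (g ^ 2) = s * Fintype.card G := by
  let b := Module.finBasis ℂ V
  let X : Fin (Module.finrank ℂ V) → Fin (Module.finrank ℂ V) → V →ₗ[ℂ] V →ₗ[ℂ] ℂ :=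
    fun i j => (LinearMap.mul ℂ ℂ).compl₁₂ (b.coord i) (b.coord j)
  have hX : ∀ i j v w, X i j v w = b.coord i v * b.coord j w := fun i j v w => rfl
  -- Averaging the coordinate form `X i j` gives a multiple `c i j` of `B`; these multiples encode
  -- the orthogonality relations for matrix coefficients.
  choose c hc using fun i j =>
    hB.exists_eq_smul hirr hB0 (isSemiInvariant_average (ρ := ρ) (χ := χ) (B := X i j))
  have hcX : ∀ i j v w, ∑ g, ((χ g)⁻¹ : ℂˣ).val * (b.coord i (ρ g v) * b.coord j (ρ g w))
      = c i j * B v w := by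
    intro i j v w
    have := congrArg (fun D => D v w) (hc i j)
    simpa [average_apply, hX] using this
  have hexp : ∀ v w, ∑ i, ∑ j, b.coord i v * b.coord j w * B (b i) (b j) = B v w := by
    intro v w
    conv_rhs => rw [← b.sum_repr v, ← b.sum_repr w]
    simp only [map_sum, LinearMap.sum_apply, map_smul, LinearMap.smul_apply, smul_eq_mul,
      Module.Basis.coord_apply, Finset.mul_sum]
    rw [Finset.sum_comm]
    refine Finset.sum_congr rfl fun i _ => Finset.sum_congr rfl fun j _ => by ring
  have htr : ∀ g, ρ.character (g ^ 2)
      = ∑ i, ∑ k, b.coord i (ρ g (b k)) * b.coord k (ρ g (b i)) := by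
    intro g
    rw [Representation.character, LinearMap.trace_eq_matrix_trace ℂ b, pow_two, map_mul,
      Module.End.mul_eq_comp, LinearMap.toMatrix_comp b b b, Matrix.trace]
    simp [Matrix.mul_apply, LinearMap.toMatrix_apply]
  -- Expand `B` in the forms `X i k` and average: a semi-invariant form averages to `|G|` times
  -- itself.
  have hsum : ∑ i, ∑ k, c i k * B (b i) (b k) = Fintype.card G := by
    obtain ⟨v, hv⟩ : ∃ v, B v ≠ 0 := by
      by_contra! h
      exact hB0 (LinearMap.ext h)
    obtain ⟨w, hw⟩ : ∃ w, B v w ≠ 0 := by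
      by_contra! h
      exact hv (LinearMap.ext h)
    refine mul_right_cancel₀ hw ?_
    calc (∑ i, ∑ k, c i k * B (b i) (b k)) * B v w
        = ∑ i, ∑ k, ∑ g, ((χ g)⁻¹ : ℂˣ).val
            * (b.coord i (ρ g v) * b.coord k (ρ g w) * B (b i) (b k)) := by
          simp only [Finset.sum_mul]
          refine Finset.sum_congr rfl fun i _ => Finset.sum_congr rfl fun k _ => ?_
          rw [mul_right_comm, ← hcX, Finset.sum_mul]
          exact Finset.sum_congr rfl fun g _ => by ring
      _ = ∑ g, ((χ g)⁻¹ : ℂˣ).val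
            * ∑ i, ∑ k, b.coord i (ρ g v) * b.coord k (ρ g w) * B (b i) (b k) := by
          simp only [Finset.mul_sum]
          symm
          rw [Finset.sum_comm]
          exact Finset.sum_congr rfl fun i _ => Finset.sum_comm
      _ = Fintype.card G * B v w := by
          simp_rw [hexp, hB _ v w]
          simp
  calc ∑ g, ((χ g)⁻¹ : ℂˣ).val * ρ.character (g ^ 2)
      = ∑ i, ∑ k, ∑ g, ((χ g)⁻¹ : ℂˣ).val
          * (b.coord i (ρ g (b k)) * b.coord k (ρ g (b i))) := by
        simp only [htr, Finset.mul_sum]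
        rw [Finset.sum_comm]
        exact Finset.sum_congr rfl fun i _ => Finset.sum_comm
    _ = s * ∑ i, ∑ k, c i k * B (b i) (b k) := by
        simp only [hcX, Finset.mul_sum]
        refine Finset.sum_congr rfl fun i _ => Finset.sum_congr rfl fun k _ => ?_
        -- The trace of a square produces `B (b k) (b i)`, with arguments in the opposite order from
        -- `hsum`; this is the source of `s`.
        rw [hs (b i) (b k)]
        ring
    _ = s * Fintype.card G := by rw [hsum]

end FrobeniusSchur

end SymRep

/-! ### Anti-automorphisms of the group algebra and forms on left ideals -/

namespace SymRep

section GroupAlgebra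

open MonoidAlgebra

variable {G : Type*} [Group G]

/-- The anti-automorphism `g ↦ χ(g) g⁻¹` of the group algebra. -/
noncomputable def adjoint (χ : G →* ℂˣ) : MonoidAlgebra ℂ G →ₗ[ℂ] MonoidAlgebra ℂ G :=
  (MulOpposite.opLinearEquiv ℂ).symm.toLinearMap ∘ₗ
    (MonoidAlgebra.lift ℂ (MonoidAlgebra ℂ G)ᵐᵒᵖ G
      { toFun := fun g => MulOpposite.op (single g⁻¹ (χ g : ℂ))
        map_one' := by simp [one_def]
        map_mul' := fun g h => by
          rw [← MulOpposite.op_mul, single_mul_single]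
          simp [mul_comm] }).toLinearMap

variable (χ : G →* ℂˣ)

lemma adjoint_single (g : G) (r : ℂ) : adjoint χ (single g r) = single g⁻¹ (r * χ g) := by
  simp [adjoint]

lemma adjoint_mul (x y : MonoidAlgebra ℂ G) :
    adjoint χ (x * y) = adjoint χ y * adjoint χ x := by
  simp [adjoint]

lemma adjoint_adjoint (x : MonoidAlgebra ℂ G) : adjoint χ (adjoint χ x) = x := by
  induction x using MonoidAlgebra.induction_linear with
  | zero => simp
  | add x y hx hy => rw [map_add, map_add, hx, hy]
  | single g r => simp [adjoint_single]

lemma coeff_adjoint (x : MonoidAlgebra ℂ G) (w : G) :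
    (adjoint χ x).coeff w = χ w⁻¹ * x.coeff w⁻¹ := by
  classical
  induction x using MonoidAlgebra.induction_linear with
  | zero => simp
  | add x y hx hy => simp only [map_add, coeff_add, Finsupp.add_apply, hx, hy, mul_add]
  | single g r =>
    rw [adjoint_single, coeff_single, coeff_single, Finsupp.single_apply, Finsupp.single_apply]
    by_cases h : g = w⁻¹
    · subst h
      simp [mul_comm]
    · rw [if_neg h, if_neg (fun h' => h (by rw [← h', inv_inv]))]
      simp

lemma coeff_one_mul_comm (x y : MonoidAlgebra ℂ G) : (x * y).coeff 1 = (y * x).coeff 1 := by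
  classical
  induction x using MonoidAlgebra.induction_linear with
  | zero => simp
  | add x x' hx hx' => simp only [add_mul, mul_add, coeff_add, Finsupp.add_apply, hx, hx']
  | single g r =>
    rw [coeff_single_mul_apply, coeff_mul_single_apply, mul_one, one_mul, mul_comm]

/-- An element of the group algebra of a finite group with a non-zero coefficient at `1` is not
square-zero. -/
lemma mul_self_ne_zero_of_coeff_one_ne_zero [Finite G] {c : MonoidAlgebra ℂ G}
    (hc : c.coeff 1 ≠ 0) : c * c ≠ 0 := by
  classical
  cases nonempty_fintype G
  intro h
  have hn : IsNilpotent (LinearMap.mulLeft ℂ c) :=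
    ⟨2, by rw [LinearMap.pow_mulLeft, pow_two, h, LinearMap.mulLeft_zero_eq_zero]⟩
  -- Every diagonal entry of left multiplication by `c` is its coefficient at `1`, while a nilpotent
  -- operator has trace zero.
  have htr : LinearMap.trace ℂ _ (LinearMap.mulLeft ℂ c) = Fintype.card G * c.coeff 1 := by
    rw [LinearMap.trace_eq_matrix_trace ℂ (MonoidAlgebra.basis G ℂ), Matrix.trace]
    have : ∀ g : G, Matrix.diag (LinearMap.toMatrix (MonoidAlgebra.basis G ℂ)
        (MonoidAlgebra.basis G ℂ) (LinearMap.mulLeft ℂ c)) g = c.coeff 1 := by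
      intro g
      rw [Matrix.diag_apply, LinearMap.toMatrix_apply, basis_apply, LinearMap.mulLeft_apply]
      change (c * single g 1).coeff g = _
      rw [coeff_mul_single_apply, mul_inv_cancel, mul_one]
    rw [Finset.sum_congr rfl fun g _ => this g]
    simp
  have h0 := (LinearMap.isNilpotent_trace_of_isNilpotent hn).eq_zero
  rw [htr] at h0
  rcases mul_eq_zero.1 h0 with h0 | h0
  · exact Fintype.card_ne_zero (Nat.cast_eq_zero.1 h0)
  · exact hc h0

variable {V : Type*} [AddCommGroup V] [Module ℂ V] {ρ : Representation ℂ G V}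

/-- The pull-back of the form `(x, y) ↦ [w] (x† y)` on the group algebra. -/
noncomputable def pullbackForm (L : V →ₗ[ℂ] MonoidAlgebra ℂ G) (w : G) : V →ₗ[ℂ] V →ₗ[ℂ] ℂ :=
  ((LinearMap.mul ℂ (MonoidAlgebra ℂ G)).compl₁₂ (adjoint χ ∘ₗ L) L).compr₂
    (Finsupp.lapply w ∘ₗ (MonoidAlgebra.coeffLinearEquiv ℂ).toLinearMap)

variable {χ} {L : V →ₗ[ℂ] MonoidAlgebra ℂ G}

lemma pullbackForm_apply (w : G) (u v : V) :
    pullbackForm χ L w u v = (adjoint χ (L u) * L v).coeff w := rfl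

/-- `(g x)† (g y) = x† (χ(g) g⁻¹) g y = χ(g) x† y`. -/
lemma isSemiInvariant_pullbackForm (hL : ∀ g v, L (ρ g v) = single g 1 * L v) (w : G) :
    IsSemiInvariant ρ χ (pullbackForm χ L w) := by
  intro g u v
  rw [pullbackForm_apply, pullbackForm_apply, hL, hL, adjoint_mul, adjoint_single, mul_assoc,
    ← mul_assoc (single g⁻¹ _), single_mul_single, inv_mul_cancel, one_mul, mul_one]
  have : (single 1 (χ g : ℂ) : MonoidAlgebra ℂ G) = (χ g : ℂ) • 1 := by simp [one_def]
  rw [this, smul_mul_assoc, one_mul, mul_smul_comm]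
  rfl

/-- `y† x = (x† y)†`, and `†` multiplies the coefficient at `w = w⁻¹` by `χ(w)`. -/
lemma pullbackForm_flip {w : G} (hw : w * w = 1) (u v : V) :
    pullbackForm χ L w v u = χ w * pullbackForm χ L w u v := by
  have h := coeff_adjoint χ (adjoint χ (L u) * L v) w
  rw [adjoint_mul, adjoint_adjoint, inv_eq_of_mul_eq_one_left hw] at h
  exact h

/-- A left ideal with an explicit generator, as the image of an equivariant embedding. -/
structure IsEmbedding (ρ : Representation ℂ G V) (L : V →ₗ[ℂ] MonoidAlgebra ℂ G)
    (c : MonoidAlgebra ℂ G) : Prop where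
  injective : Function.Injective L
  map_rho : ∀ g v, L (ρ g v) = single g 1 * L v
  exists_apply_eq_mul : ∀ x, ∃ v, L v = x * c
  exists_eq_mul : ∀ v, ∃ x, L v = x * c

lemma exists_isEmbedding {c : MonoidAlgebra ℂ G}
    (e : ρ.asModule ≃ₗ[MonoidAlgebra ℂ G] Ideal.span {c}) :
    ∃ L : V →ₗ[ℂ] MonoidAlgebra ℂ G, IsEmbedding ρ L c := by
  refine ⟨{ toFun := fun v => (e (ρ.asModuleEquiv.symm v) : MonoidAlgebra ℂ G)
            map_add' := fun u v => by simp
            map_smul' := fun r v => ?_ }, ?_, ?_, ?_, ?_⟩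
  · rw [Representation.asModuleEquiv_symm_map_smul, map_smul, Submodule.coe_smul, smul_eq_mul,
      ← Algebra.smul_def, RingHom.id_apply]
  · intro u v h
    exact ρ.asModuleEquiv.symm.injective (e.injective (Subtype.ext h))
  · intro g v
    change (e (ρ.asModuleEquiv.symm (ρ g v)) : MonoidAlgebra ℂ G) = _
    rw [Representation.asModuleEquiv_symm_map_rho, map_smul]
    rfl
  · intro x
    refine ⟨ρ.asModuleEquiv (e.symm ⟨x * c, Ideal.mem_span_singleton'.2 ⟨x, rfl⟩⟩), ?_⟩
    simp
  · intro v
    obtain ⟨x, hx⟩ := Ideal.mem_span_singleton'.1 (e (ρ.asModuleEquiv.symm v)).2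
    exact ⟨x, hx.symm⟩

lemma IsEmbedding.finiteDimensional [Finite G] {c : MonoidAlgebra ℂ G} (h : IsEmbedding ρ L c) :
    FiniteDimensional ℂ V :=
  FiniteDimensional.of_injective L h.injective

/-- The form attached to `χ` and `w` does not vanish on a left ideal `ℂ[G] c` if
`c† = w c' w` with `c c' ≠ 0`. -/
lemma IsEmbedding.pullbackForm_ne_zero {c c' : MonoidAlgebra ℂ G} (h : IsEmbedding ρ L c) {w : G}
    (hw : w * w = 1) (hc : adjoint χ c = single w 1 * c' * single w 1) (hcc : c * c' ≠ 0) :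
    pullbackForm χ L w ≠ 0 := by
  intro h0
  refine hcc (MonoidAlgebra.ext (Finsupp.ext fun g => ?_))
  -- Evaluated at `(g w) c` and `c`, the form gives `χ(gw)` times `[1](c' g⁻¹ c) = [g](c c')`, so
  -- its vanishing would kill every coefficient of `c c'`.
  obtain ⟨u, hu⟩ := h.exists_apply_eq_mul (single (g * w) 1)
  obtain ⟨v, hv⟩ := h.exists_apply_eq_mul 1
  have hwi : w⁻¹ = w := inv_eq_of_mul_eq_one_left hw
  have h1 : pullbackForm χ L w u v = χ (g * w) * (c * c').coeff g := by
    rw [pullbackForm_apply, hu, hv, adjoint_mul, adjoint_single, hc, one_mul, one_mul, mul_assoc,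
      mul_assoc, mul_assoc, ← mul_assoc (single w 1) (single _ _), single_mul_single,
      mul_inv_rev, hwi, ← mul_assoc w, hw, one_mul, one_mul, coeff_single_mul_apply, one_mul,
      inv_mul_cancel, coeff_one_mul_comm, mul_assoc, coeff_single_mul_apply, inv_inv, mul_one]
  rw [h0] at h1
  exact (mul_eq_zero.1 h1.symm).resolve_left (Units.ne_zero _)

end GroupAlgebra

end SymRep

/-! ### Weighted sums over label-preserving permutations -/

namespace SymRep

section LabelSums

open MonoidAlgebra

variable {d : ℕ}

/-- The sign, as a linear character with values in `ℂˣ`. -/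
noncomputable def signChar (d : ℕ) : Equiv.Perm (Fin d) →* ℂˣ :=
  (Units.map (Int.castRingHom ℂ : ℤ →* ℂ)).comp Equiv.Perm.sign

lemma signChar_apply (g : Equiv.Perm (Fin d)) :
    (signChar d g : ℂ) = ((Equiv.Perm.sign g : ℤ) : ℂ) := rfl

lemma signChar_mul_self : signChar d * signChar d = 1 := by
  ext g
  rw [MonoidHom.mul_apply, Units.val_mul, signChar_apply]
  rcases Int.units_eq_one_or (Equiv.Perm.sign g) with h | h <;> simp [h]

lemma signChar_inv : (signChar d)⁻¹ = signChar d :=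
  MonoidHom.ext fun g => inv_eq_of_mul_eq_one_left (DFunLike.congr_fun signChar_mul_self g)

open Classical in
/-- The permutations which preserve a labelling. -/
noncomputable def labelStabilizer (f : Fin d → ℕ) : Finset (Equiv.Perm (Fin d)) :=
  {g | ∀ x, f (g x) = f x}

lemma mem_labelStabilizer {f : Fin d → ℕ} {g : Equiv.Perm (Fin d)} :
    g ∈ labelStabilizer f ↔ ∀ x, f (g x) = f x := by
  simp [labelStabilizer]

lemma mul_mem_labelStabilizer {f : Fin d → ℕ} {g h : Equiv.Perm (Fin d)}
    (hg : g ∈ labelStabilizer f) (hh : h ∈ labelStabilizer f) : g * h ∈ labelStabilizer f := by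
  rw [mem_labelStabilizer] at *
  intro x
  rw [Equiv.Perm.mul_apply, hg, hh]

lemma inv_mem_labelStabilizer {f : Fin d → ℕ} {g : Equiv.Perm (Fin d)}
    (hg : g ∈ labelStabilizer f) : g⁻¹ ∈ labelStabilizer f := by
  rw [mem_labelStabilizer] at *
  intro x
  rw [← hg, ← Equiv.Perm.mul_apply, mul_inv_cancel, Equiv.Perm.one_apply]

lemma one_mem_labelStabilizer (f : Fin d → ℕ) : 1 ∈ labelStabilizer f := by
  simp [mem_labelStabilizer]

/-- The sum of `χ(g) g` over the permutations preserving a labelling. -/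
noncomputable def labelSum (χ : Equiv.Perm (Fin d) →* ℂˣ) (f : Fin d → ℕ) :
    MonoidAlgebra ℂ (Equiv.Perm (Fin d)) :=
  ∑ g ∈ labelStabilizer f, single g (χ g : ℂ)

variable (χ ψ : Equiv.Perm (Fin d) →* ℂˣ) (f : Fin d → ℕ)

/-- The stabilizer is closed under inversion. For `χ = sgn` this exchanges signed and unsigned sums.
-/
lemma adjoint_labelSum : adjoint χ (labelSum ψ f) = labelSum (ψ * χ)⁻¹ f := by
  rw [labelSum, map_sum, labelSum]
  refine Finset.sum_nbij' (·⁻¹) (·⁻¹) (fun g hg => inv_mem_labelStabilizer hg)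
    (fun g hg => inv_mem_labelStabilizer hg) (by simp) (by simp) fun g _ => ?_
  rw [adjoint_single]
  simp [mul_comm]

lemma single_mul_labelSum {g : Equiv.Perm (Fin d)} (hg : g ∈ labelStabilizer f) :
    single g (χ g : ℂ) * labelSum χ f = labelSum χ f := by
  rw [labelSum, Finset.mul_sum]
  refine Finset.sum_nbij' (g * ·) (g⁻¹ * ·) (fun h hh => mul_mem_labelStabilizer hg hh)
    (fun h hh => mul_mem_labelStabilizer (inv_mem_labelStabilizer hg) hh) (by simp) (by simp)
    fun h _ => ?_
  rw [single_mul_single, map_mul, Units.val_mul]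

lemma labelSum_mul_single {g : Equiv.Perm (Fin d)} (hg : g ∈ labelStabilizer f) :
    labelSum χ f * single g (χ g : ℂ) = labelSum χ f := by
  rw [labelSum, Finset.sum_mul]
  refine Finset.sum_nbij' (· * g) (· * g⁻¹) (fun h hh => mul_mem_labelStabilizer hh hg)
    (fun h hh => mul_mem_labelStabilizer hh (inv_mem_labelStabilizer hg)) (by simp) (by simp)
    fun h _ => ?_
  rw [single_mul_single, map_mul, Units.val_mul]

lemma labelSum_mul_self :
    labelSum χ f * labelSum χ f = ((labelStabilizer f).card : ℂ) • labelSum χ f := by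
  conv_lhs => enter [1]; rw [labelSum]
  rw [Finset.sum_mul, Finset.sum_congr rfl fun g hg => single_mul_labelSum χ f hg,
    Finset.sum_const, Nat.cast_smul_eq_nsmul]

lemma card_labelStabilizer_ne_zero : ((labelStabilizer f).card : ℂ) ≠ 0 :=
  Nat.cast_ne_zero.2 (Finset.card_ne_zero_of_mem (one_mem_labelStabilizer f))

lemma conj_labelSum {w : Equiv.Perm (Fin d)} (hw : w * w = 1) :
    single w 1 * labelSum χ f * single w 1 = labelSum χ (f ∘ w) := by
  have hww : ∀ x, w (w x) = x := fun x => by rw [← Equiv.Perm.mul_apply, hw, Equiv.Perm.one_apply]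
  have hww' : ∀ g, w * (w * g * w) * w = g := fun g => by
    rw [← mul_assoc, ← mul_assoc, hw, one_mul, mul_assoc, hw, mul_one]
  rw [labelSum, labelSum, Finset.mul_sum, Finset.sum_mul]
  refine Finset.sum_nbij' (w * · * w) (w * · * w) (fun g hg => ?_) (fun g hg => ?_)
    (fun g _ => hww' g) (fun g _ => hww' g) fun g _ => ?_
  · rw [mem_labelStabilizer] at *
    intro x
    simp [hww, hg]
  · rw [mem_labelStabilizer] at *
    intro x
    have := hg (w x)
    simpa [hww] using this
  · rw [single_mul_single, single_mul_single, one_mul, mul_one, map_mul, map_mul]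
    congr 2
    rw [mul_comm (χ w), mul_assoc, ← map_mul, hw, map_one, mul_one]

/-- If no transposition preserves both a labelling and its translate, the fibres of the first are
transversal to those of the second. -/
lemma ne_of_labelSum_mul_ne_zero {χ ψ : Equiv.Perm (Fin d) →* ℂˣ} {f : Fin d → ℕ}
    (hχψ : ∀ x y, x ≠ y → χ (Equiv.swap x y) ≠ ψ (Equiv.swap x y)) {g : Equiv.Perm (Fin d)}
    (h : labelSum χ f * single g 1 * labelSum ψ f ≠ 0) {x y : Fin d} (hxy : x ≠ y)
    (hf : f (g x) = f (g y)) : f x ≠ f y := by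
  intro hf'
  have hswap : ∀ {u v : Fin d}, f u = f v → Equiv.swap u v ∈ labelStabilizer f := by
    intro u v huv
    rw [mem_labelStabilizer]
    intro z
    rw [Equiv.swap_apply_def]
    split_ifs with h1 h2
    · rw [h1, huv]
    · rw [h2, huv]
    · rfl
  have hψ := single_mul_labelSum ψ f (hswap hf')
  have hχ := labelSum_mul_single χ f (hswap hf)
  have hconj : Equiv.swap (g x) (g y) * g = g * Equiv.swap x y := by
    rw [Equiv.swap_apply_apply]
    simp
  have hcχ : χ (Equiv.swap (g x) (g y)) = χ (Equiv.swap x y) := by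
    rw [Equiv.swap_apply_apply, map_mul, map_mul, map_inv, mul_right_comm, mul_inv_cancel, one_mul]
  -- With `t = (x y)`, absorbing `t` into the right factor yields the scalar `ψ(t)`, and absorbing
  -- `g t g⁻¹` into the left yields `χ(t)`, on the same nonzero product.
  have h1 : labelSum χ f * single g 1 * labelSum ψ f = (ψ (Equiv.swap x y) : ℂ) •
      (labelSum χ f * single (g * Equiv.swap x y) 1 * labelSum ψ f) := by
    conv_lhs => rw [← hψ]
    rw [← mul_assoc, mul_assoc (labelSum χ f), single_mul_single, one_mul, ← smul_mul_assoc,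
      ← mul_smul_comm, smul_single, smul_eq_mul, mul_one]
  have h2 : labelSum χ f * single g 1 * labelSum ψ f = (χ (Equiv.swap x y) : ℂ) •
      (labelSum χ f * single (g * Equiv.swap x y) 1 * labelSum ψ f) := by
    conv_lhs => rw [← hχ]
    rw [mul_assoc (labelSum χ f), single_mul_single, mul_one, hcχ, hconj, ← smul_mul_assoc,
      ← mul_smul_comm, smul_single, smul_eq_mul, mul_one]
  have h3 : labelSum χ f * single (g * Equiv.swap x y) 1 * labelSum ψ f ≠ 0 := by
    intro h0
    rw [h1, h0, smul_zero] at h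
    exact h rfl
  exact hχψ x y hxy (Units.ext (smul_left_injective ℂ h3 (h2.symm.trans h1)))

/-- Passing from a representation to its conjugate twists the label sums which do not kill it. -/
lemma IsEmbedding.exists_labelSum_mul_ne_zero {V : Type*} [AddCommGroup V] [Module ℂ V]
    {ρ : Representation ℂ (Equiv.Perm (Fin d)) V}
    {L : V →ₗ[ℂ] MonoidAlgebra ℂ (Equiv.Perm (Fin d))} {c : MonoidAlgebra ℂ (Equiv.Perm (Fin d))}
    (hL : IsEmbedding ρ L c) (hself : IsSelfConjugate ρ) (hc : labelSum χ f * c ≠ 0) :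
    ∃ x, labelSum (χ * signChar d) f * (x * c) ≠ 0 := by
  obtain ⟨φ⟩ := hself
  have hφ : ∀ g v, φ (ρ g v) = (signChar d g : ℂ) • ρ g (φ v) := fun g v =>
    Representation.IntertwiningMap.isIntertwining _ _ φ.toIntertwiningMap g v
  have hsum : ∀ (ψ : Equiv.Perm (Fin d) →* ℂˣ) v,
      L (∑ g ∈ labelStabilizer f, (ψ g : ℂ) • ρ g v) = labelSum ψ f * L v := by
    intro ψ v
    rw [map_sum, labelSum, Finset.sum_mul]
    refine Finset.sum_congr rfl fun g _ => ?_
    rw [map_smul, hL.map_rho, ← smul_mul_assoc, smul_single, smul_eq_mul, mul_one]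
  obtain ⟨v, hv⟩ := hL.exists_apply_eq_mul 1
  rw [one_mul] at hv
  obtain ⟨x, hx⟩ := hL.exists_eq_mul (φ v)
  refine ⟨x, fun h0 => hc ?_⟩
  rw [← hx, ← hsum, ← map_zero L] at h0
  have h1 := hL.injective h0
  rw [← hv, ← hsum]
  -- The isomorphism `φ` with the conjugate representation turns the `χ`-weighted sum acting on `v`
  -- into the `χ · sgn`-weighted sum acting on `φ v`.
  have h2 : φ (∑ g ∈ labelStabilizer f, (χ g : ℂ) • ρ g v) = 0 := by
    rw [← h1, map_sum]
    refine Finset.sum_congr rfl fun g _ => ?_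
    rw [map_smul, hφ, smul_smul]
    rfl
  have h3 : ∑ g ∈ labelStabilizer f, (χ g : ℂ) • ρ g v = 0 :=
    φ.toLinearEquiv.injective (h2.trans (map_zero φ.toLinearEquiv).symm)
  rw [h3, map_zero]

end LabelSums

end SymRep

/-! ### Symmetry of the diagram by dominance -/

namespace SymRep

open MonoidAlgebra

section Counting

/-- If a permutation carries the fibres of `p` to transversals of the fibres of `p`, and `q` takes
small values as often as possible on each fibre of `p`, then `q` takes small values at least as often
as `p`. -/
lemma card_filter_lt_le {X : Type*} [Fintype X] [DecidableEq X] (p q : X → ℕ) (h : Equiv.Perm X)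
    (hpq : ∀ j k, min k (Finset.card {x | p x = j}) ≤ Finset.card {x | p x = j ∧ q x < k})
    (hh : ∀ x y, x ≠ y → p (h x) = p (h y) → p x ≠ p y) (k : ℕ) :
    Finset.card {x | p x < k} ≤ Finset.card {x | q x < k} := by
  -- The left side is split by `p ∘ h`, the right by `p`. On a fibre of `p ∘ h` the map `p` is
  -- injective, giving at most `k` points, and `h` embeds it in the fibre of `p`.
  rw [Finset.card_eq_sum_card_fiberwise (s := {x | p x < k}) (f := fun x => p (h x))
      (t := Finset.univ.image p) (fun x _ => by simp),
    Finset.card_eq_sum_card_fiberwise (s := {x | q x < k}) (f := p)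
      (t := Finset.univ.image p) (fun x _ => by simp)]
  refine Finset.sum_le_sum fun j _ => ?_
  rw [Finset.filter_filter, Finset.filter_filter]
  calc _ ≤ min k (Finset.card {x | p x = j}) := by
        refine le_min ?_ ?_
        · rw [← Finset.card_range k]
          refine Finset.card_le_card_of_injOn p (fun x hx => ?_) fun x hx y hy hxy => ?_
          · simp only [Finset.coe_filter, Finset.mem_univ, true_and, Set.mem_ofPred_eq] at hx
            simpa using hx.1
          · simp only [Finset.coe_filter, Finset.mem_univ, true_and, Set.mem_ofPred_eq] at hx hy
            by_contra hne
            exact hh x y hne (hx.2.trans hy.2.symm) hxy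
        · refine Finset.card_le_card_of_injOn h (fun x hx => ?_) h.injective.injOn
          simp only [Finset.coe_filter, Finset.mem_univ, true_and, Set.mem_ofPred_eq] at hx ⊢
          exact hx.2
    _ ≤ _ := hpq j k
    _ = _ := by simp only [and_comm]

end Counting

section Tableau

variable {d : ℕ} {μ : YoungDiagram} (T : μ.cells ≃ Fin d)

/-- The row in which an entry of a tableau lies. -/
def rowLabel (x : Fin d) : ℕ := (T.symm x).1.1

/-- The column in which an entry of a tableau lies. -/
def colLabel (x : Fin d) : ℕ := (T.symm x).1.2

lemma rowSum_eq_labelSum : rowSum T = labelSum 1 (rowLabel T) := by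
  rw [rowSum, labelSum]
  refine Finset.sum_congr ?_ fun g _ => by simp
  ext g
  simp [mem_labelStabilizer, rowLabel]

lemma colSum_eq_labelSum : colSum T = labelSum (signChar d) (colLabel T) := by
  rw [colSum, labelSum]
  refine Finset.sum_congr ?_ fun g _ => by rw [signChar_apply]
  ext g
  simp [mem_labelStabilizer, colLabel]

lemma card_filter_tableau (P : ℕ × ℕ → Prop) [DecidablePred P] :
    Finset.card {x | P (T.symm x).1} = (μ.cells.filter P).card := by
  rw [← Finset.card_image_of_injective _ (Subtype.val_injective.comp T.symm.injective)]
  congr 1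
  ext c
  simp only [Finset.mem_image, Finset.mem_filter, Finset.mem_univ, true_and, Function.comp_apply]
  constructor
  · rintro ⟨x, hx, rfl⟩
    exact ⟨(T.symm x).2, hx⟩
  · rintro ⟨hc, hP⟩
    exact ⟨T ⟨c, hc⟩, by simpa using hP, by simp⟩

lemma eq_of_rowLabel_eq_of_colLabel_eq {x y : Fin d} (h1 : rowLabel T x = rowLabel T y)
    (h2 : colLabel T x = colLabel T y) : x = y :=
  T.symm.injective (Subtype.ext (Prod.ext h1 h2))

/-- The row and column groups meet only in the identity, so `1` arises only as `1 * 1`. -/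
lemma coeff_one_youngSymmetrizer : (youngSymmetrizer T).coeff 1 = 1 := by
  classical
  have h : ∀ g ∈ labelStabilizer (rowLabel T),
      (single g ((1 : Equiv.Perm (Fin d) →* ℂˣ) g : ℂ)
        * labelSum (signChar d) (colLabel T)).coeff 1 = if g = 1 then 1 else 0 := by
    intro g hg
    rw [coeff_single_mul_apply, mul_one, labelSum, coeff_sum, Finsupp.finsetSum_apply]
    simp only [coeff_single, Finsupp.single_apply]
    rw [Finset.sum_ite_eq']
    have hiff : g⁻¹ ∈ labelStabilizer (colLabel T) ↔ g = 1 := by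
      refine ⟨fun hg' => ?_, fun hg' => hg' ▸ by simpa using one_mem_labelStabilizer _⟩
      ext1 x
      have hg'' := inv_mem_labelStabilizer hg'
      rw [inv_inv] at hg''
      exact eq_of_rowLabel_eq_of_colLabel_eq T (mem_labelStabilizer.1 hg x)
        (mem_labelStabilizer.1 hg'' x)
    by_cases hg1 : g = 1
    · subst hg1
      rw [if_pos (hiff.2 rfl)]
      simp
    · rw [if_neg (fun h => hg1 (hiff.1 h)), if_neg hg1, mul_zero]
  rw [youngSymmetrizer, rowSum_eq_labelSum, colSum_eq_labelSum, labelSum, Finset.sum_mul,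
    coeff_sum, Finsupp.finsetSum_apply, Finset.sum_congr rfl h, Finset.sum_ite_eq',
    if_pos (one_mem_labelStabilizer _)]

lemma youngSymmetrizer_mul_self_ne_zero : youngSymmetrizer T * youngSymmetrizer T ≠ 0 :=
  mul_self_ne_zero_of_coeff_one_ne_zero (by rw [coeff_one_youngSymmetrizer]; exact one_ne_zero)

lemma exists_mul_single_mul_ne_zero {G : Type*} [Group G] {a b x : MonoidAlgebra ℂ G}
    (h : a * x * b ≠ 0) : ∃ g, a * single g 1 * b ≠ 0 := by
  by_contra! h0
  refine h ?_
  induction x using MonoidAlgebra.induction_linear with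
  | zero => simp
  | add x y hx hy =>
    by_cases h1 : a * x * b = 0
    · by_cases h2 : a * y * b = 0
      · rw [mul_add, add_mul, h1, h2, add_zero]
      · exact absurd (hy h2) h2
    · exact absurd (hx h1) h1
  | single g r =>
    have : (single g r : MonoidAlgebra ℂ G) = r • single g 1 := by simp
    rw [this, mul_smul_comm, smul_mul_assoc, h0, smul_zero]

lemma signChar_swap_ne_one {x y : Fin d} (h : x ≠ y) :
    signChar d (Equiv.swap x y) ≠ (1 : Equiv.Perm (Fin d) →* ℂˣ) (Equiv.swap x y) := by
  intro h0
  have := congrArg Units.val h0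
  rw [signChar_apply, Equiv.Perm.sign_swap h] at this
  norm_num at this

/-- Rows are left-justified, so row `j` has `min k (μ.rowLen j)` boxes in the first `k` columns, as
`card_filter_lt_le` requires. This is dominance of `μ` by its transpose. -/
lemma card_rowLabel_lt_le {g : Equiv.Perm (Fin d)}
    (h : ∀ x y, x ≠ y → rowLabel T (g x) = rowLabel T (g y) → rowLabel T x ≠ rowLabel T y)
    (k : ℕ) : (μ.cells.filter fun c => c.1 < k).card ≤ (μ.cells.filter fun c => c.2 < k).card := by
  rw [← card_filter_tableau T, ← card_filter_tableau T]
  refine card_filter_lt_le (rowLabel T) (colLabel T) g (fun j k => ?_) h k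
  have h1 : Finset.card {x | rowLabel T x = j} = _ := card_filter_tableau T (fun c => c.1 = j)
  have h2 : Finset.card {x | rowLabel T x = j ∧ colLabel T x < k} = _ :=
    card_filter_tableau T (fun c => c.1 = j ∧ c.2 < k)
  have h3 : (μ.cells.filter fun c => c.1 = j).card = μ.rowLen j := (μ.rowLen_eq_card).symm
  rw [h1, h2, h3, ← Finset.card_range (min k _)]
  refine Finset.card_le_card_of_injOn (fun i => (j, i)) (fun i hi => ?_) (by simp [Set.InjOn])
  simp only [Finset.coe_range, Set.mem_Iio, lt_min_iff] at hi
  simpa [YoungDiagram.mem_iff_lt_rowLen] using hi.symm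

lemma card_colLabel_lt_le {g : Equiv.Perm (Fin d)}
    (h : ∀ x y, x ≠ y → colLabel T (g x) = colLabel T (g y) → colLabel T x ≠ colLabel T y)
    (k : ℕ) : (μ.cells.filter fun c => c.2 < k).card ≤ (μ.cells.filter fun c => c.1 < k).card := by
  rw [← card_filter_tableau T, ← card_filter_tableau T]
  refine card_filter_lt_le (colLabel T) (rowLabel T) g (fun j k => ?_) h k
  have h1 : Finset.card {x | colLabel T x = j} = _ := card_filter_tableau T (fun c => c.2 = j)
  have h2 : Finset.card {x | colLabel T x = j ∧ rowLabel T x < k} = _ :=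
    card_filter_tableau T (fun c => c.2 = j ∧ c.1 < k)
  have h3 : (μ.cells.filter fun c => c.2 = j).card = μ.colLen j := (μ.colLen_eq_card).symm
  rw [h1, h2, h3, ← Finset.card_range (min k _)]
  refine Finset.card_le_card_of_injOn (fun i => (i, j)) (fun i hi => ?_) (by simp [Set.InjOn])
  simp only [Finset.coe_range, Set.mem_Iio, lt_min_iff] at hi
  simpa [YoungDiagram.mem_iff_lt_colLen] using hi.symm

lemma swap_mem_of_card_eq
    (h : ∀ k, (μ.cells.filter fun c => c.1 < k).card = (μ.cells.filter fun c => c.2 < k).card)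
    {c : ℕ × ℕ} (hc : c ∈ μ) : c.swap ∈ μ := by
  have hlen : ∀ k, μ.rowLen k = μ.colLen k := by
    intro k
    have h1 : (μ.cells.filter fun c => c.1 < k + 1).card
        = (μ.cells.filter fun c => c.1 < k).card + μ.rowLen k := by
      rw [μ.rowLen_eq_card, YoungDiagram.row, ← Finset.card_union_of_disjoint, ← Finset.filter_or]
      · simp only [Nat.lt_succ_iff_lt_or_eq]
      · exact Finset.disjoint_filter.2 fun c _ h1 h2 => by omega
    have h2 : (μ.cells.filter fun c => c.2 < k + 1).card
        = (μ.cells.filter fun c => c.2 < k).card + μ.colLen k := by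
      rw [μ.colLen_eq_card, YoungDiagram.col, ← Finset.card_union_of_disjoint, ← Finset.filter_or]
      · simp only [Nat.lt_succ_iff_lt_or_eq]
      · exact Finset.disjoint_filter.2 fun c _ h1 h2 => by omega
    have := h k
    have := h (k + 1)
    omega
  obtain ⟨i, j⟩ := c
  rw [YoungDiagram.mem_iff_lt_rowLen, hlen] at hc
  exact YoungDiagram.mem_iff_lt_colLen.2 hc

/-- The Young diagram of a self-conjugate representation is symmetric. -/
lemma swap_mem_of_isSelfConjugate {V : Type*} [AddCommGroup V] [Module ℂ V]
    {ρ : Representation ℂ (Equiv.Perm (Fin d)) V}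
    {L : V →ₗ[ℂ] MonoidAlgebra ℂ (Equiv.Perm (Fin d))}
    (hL : IsEmbedding ρ L (youngSymmetrizer T)) (hself : IsSelfConjugate ρ)
    {c : ℕ × ℕ} (hc : c ∈ μ) : c.swap ∈ μ := by
  have hcc := youngSymmetrizer_mul_self_ne_zero T
  have hT : youngSymmetrizer T
      = labelSum 1 (rowLabel T) * labelSum (signChar d) (colLabel T) := by
    rw [youngSymmetrizer, rowSum_eq_labelSum, colSum_eq_labelSum]
  -- With `c = a b`: `a c` is a nonzero multiple of `c`, and below `b c ≠ 0` because `a (b c) = c² ≠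
  -- 0`.
  have hrow : labelSum 1 (rowLabel T) * youngSymmetrizer T ≠ 0 := by
    rw [hT, ← mul_assoc, labelSum_mul_self, smul_mul_assoc, ← hT]
    refine smul_ne_zero (card_labelStabilizer_ne_zero _) fun h => hcc ?_
    rw [h, mul_zero]
  have hcol : labelSum (signChar d) (colLabel T) * youngSymmetrizer T ≠ 0 := by
    intro h
    refine hcc ?_
    conv_lhs => enter [1]; rw [hT]
    rw [mul_assoc, h, mul_zero]
  -- Self-conjugacy makes the signed row sum, and then the unsigned column sum, act nontrivially
  -- too, so both weightings of each occur in one nonzero product.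
  obtain ⟨x, hx⟩ := hL.exists_labelSum_mul_ne_zero _ _ hself hrow
  obtain ⟨y, hy⟩ := hL.exists_labelSum_mul_ne_zero _ _ hself hcol
  have hone : 1 * signChar d = signChar d := MonoidHom.ext fun g => one_mul _
  rw [hone, hT, ← mul_assoc, ← mul_assoc] at hx
  rw [signChar_mul_self, hT, ← mul_assoc y, ← mul_assoc] at hy
  obtain ⟨g, hg⟩ := exists_mul_single_mul_ne_zero (left_ne_zero_of_mul hx)
  obtain ⟨g', hg'⟩ := exists_mul_single_mul_ne_zero hy
  exact swap_mem_of_card_eq (fun k => le_antisymm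
    (card_rowLabel_lt_le T (fun u v huv => ne_of_labelSum_mul_ne_zero
      (fun _ _ h => signChar_swap_ne_one h) hg huv) k)
    (card_colLabel_lt_le T (fun u v huv => ne_of_labelSum_mul_ne_zero
      (fun _ _ h => (signChar_swap_ne_one h).symm) hg' huv) k)) hc

end Tableau

end SymRep

/-! ### Reflection of the tableau and the two nonvanishing forms -/

namespace SymRep

open MonoidAlgebra

section Transpose

variable {d : ℕ} {μ : YoungDiagram} (T : μ.cells ≃ Fin d)

/-- The permutation of the entries of a tableau of symmetric shape given by reflection in the main
diagonal. -/
def reflection (hμ : ∀ c ∈ μ, c.swap ∈ μ) : Equiv.Perm (Fin d) :=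
  T.permCongr
    { toFun := fun c => ⟨c.1.swap, hμ _ c.2⟩
      invFun := fun c => ⟨c.1.swap, hμ _ c.2⟩
      left_inv := fun _ => rfl
      right_inv := fun _ => rfl }

variable (hμ : ∀ c ∈ μ, c.swap ∈ μ)

lemma symm_reflection (x : Fin d) :
    (T.symm (reflection T hμ x)).1 = (T.symm x).1.swap := by
  simp [reflection, Equiv.permCongr_apply]

lemma reflection_mul_self : reflection T hμ * reflection T hμ = 1 := by
  ext1 x
  refine T.symm.injective (Subtype.ext ?_)
  rw [Equiv.Perm.mul_apply, symm_reflection, symm_reflection, Prod.swap_swap, Equiv.Perm.one_apply]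

lemma card_fixedPoints_reflection :
    Fintype.card (Function.fixedPoints (reflection T hμ)) = rank μ := by
  classical
  rw [rank, ← card_filter_tableau T (fun c => c.1 = c.2), Fintype.card_subtype]
  congr 1
  ext x
  simp only [Finset.mem_filter, Finset.mem_univ, true_and, Function.mem_fixedPoints,
    Function.IsFixedPt]
  rw [← T.symm.injective.eq_iff, Subtype.ext_iff, symm_reflection, Prod.ext_iff]
  simp only [Prod.fst_swap, Prod.snd_swap]
  exact ⟨fun h => h.2, fun h => ⟨h.symm, h⟩⟩

lemma signChar_reflection :
    (signChar d (reflection T hμ) : ℂ) = (-1) ^ ((d - rank μ) / 2) := by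
  rw [signChar_apply, Equiv.Perm.sign_of_pow_two_eq_one
    (by rw [pow_two, reflection_mul_self]), card_fixedPoints_reflection, Fintype.card_fin]
  push_cast
  rfl

lemma rank_le_and_even {d : ℕ} {μ : YoungDiagram} (T : μ.cells ≃ Fin d)
    (hμ : ∀ c ∈ μ, c.swap ∈ μ) : rank μ ≤ d ∧ Even (d - rank μ) := by
  classical
  have h := card_fixedPoints_reflection T hμ
  have h2 := Equiv.Perm.two_dvd_card_support (σ := reflection T hμ)
    (by rw [pow_two, reflection_mul_self])
  have h3 := (reflection T hμ).support.card_le_univ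
  rw [Equiv.Perm.card_fixedPoints, Equiv.Perm.sum_cycleType, Fintype.card_fin] at h
  rw [Fintype.card_fin] at h3
  refine ⟨by omega, even_iff_two_dvd.2 ?_⟩
  rwa [← h, Nat.sub_sub_self h3]

lemma youngSymmetrizer_eq_labelSum : youngSymmetrizer T
    = labelSum 1 (rowLabel T) * labelSum (signChar d) (colLabel T) := by
  rw [youngSymmetrizer, rowSum_eq_labelSum, colSum_eq_labelSum]

/-- `(a b)† = b† a†`, where `b†` is the unsigned column sum and `a†` the signed row sum. Reflection
exchanges rows and columns, so these are `w a w` and `w b w`. -/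
lemma adjoint_signChar_youngSymmetrizer :
    adjoint (signChar d) (youngSymmetrizer T)
      = single (reflection T hμ) 1 * youngSymmetrizer T * single (reflection T hμ) 1 := by
  have hrow : rowLabel T ∘ reflection T hμ = colLabel T :=
    funext fun x => congrArg Prod.fst (symm_reflection T hμ x)
  have hcol : colLabel T ∘ reflection T hμ = rowLabel T :=
    funext fun x => congrArg Prod.snd (symm_reflection T hμ x)
  have hw := reflection_mul_self T hμ
  have hww : (single (reflection T hμ) 1 * single (reflection T hμ) 1 :
      MonoidAlgebra ℂ (Equiv.Perm (Fin d))) = 1 := by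
    rw [single_mul_single, hw, one_mul, one_def]
  have hone : (1 * signChar d)⁻¹ = signChar d := by
    conv_rhs => rw [← signChar_inv]
    exact MonoidHom.ext fun g => by simp
  have hone' : (signChar d * signChar d)⁻¹ = 1 := by
    rw [signChar_mul_self]
    exact MonoidHom.ext fun g => by simp
  rw [youngSymmetrizer_eq_labelSum, adjoint_mul, adjoint_labelSum, adjoint_labelSum, hone, hone',
    ← hrow, ← conj_labelSum _ _ hw]
  conv_lhs => enter [2, 2]; rw [← hcol]
  rw [← conj_labelSum _ _ hw]
  simp only [mul_assoc]
  rw [← mul_assoc (single _ _) (single _ _), hww, one_mul, hrow]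

lemma adjoint_one_youngSymmetrizer :
    adjoint 1 (youngSymmetrizer T)
      = single 1 1 * (labelSum (signChar d) (colLabel T) * labelSum 1 (rowLabel T)) * single 1 1 := by
  have hone : ((1 : Equiv.Perm (Fin d) →* ℂˣ) * 1)⁻¹ = 1 := MonoidHom.ext fun g => by simp
  have hone' : (signChar d * 1)⁻¹ = signChar d := by
    conv_rhs => rw [← signChar_inv]
    exact MonoidHom.ext fun g => by simp
  rw [youngSymmetrizer_eq_labelSum, adjoint_mul, adjoint_labelSum, adjoint_labelSum, hone, hone',
    ← one_def, one_mul, mul_one]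

/-- `a b · b a` is a nonzero multiple of `a b a`, and `a b a · b = c_T² ≠ 0`. -/
lemma youngSymmetrizer_mul_ne_zero :
    youngSymmetrizer T * (labelSum (signChar d) (colLabel T) * labelSum 1 (rowLabel T)) ≠ 0 := by
  intro h
  refine youngSymmetrizer_mul_self_ne_zero T ?_
  rw [youngSymmetrizer_eq_labelSum] at h ⊢
  rw [← mul_assoc, mul_assoc _ (labelSum (signChar d) _) (labelSum (signChar d) _),
    labelSum_mul_self, mul_smul_comm, smul_mul_assoc] at h
  have h' := (smul_eq_zero.1 h).resolve_left (card_labelStabilizer_ne_zero _)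
  rw [← mul_assoc, h', zero_mul]

end Transpose

end SymRep

theorem mainTheorem11 (d : ℕ) {V : Type*} [AddCommGroup V] [Module ℂ V]
    (ρ : Representation ℂ (Equiv.Perm (Fin d)) V) (hirr : ρ.IsIrreducible)
    (hself : SymRep.IsSelfConjugate ρ)
    (μ : YoungDiagram) (hμ : SymRep.HasYoungDiagram ρ μ) :
    (SymRep.o ρ = 0 ∨ SymRep.o ρ = 1) ∧
      SymRep.rank μ ≤ d ∧ Even (d - SymRep.rank μ) ∧
      SymRep.epsilon ρ = (-1) ^ ((d - SymRep.rank μ) / 2) := by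
  obtain ⟨T, ⟨e⟩⟩ := hμ
  obtain ⟨L, hL⟩ := SymRep.exists_isEmbedding e
  have hsymm : ∀ c ∈ μ, c.swap ∈ μ := fun c hc => SymRep.swap_mem_of_isSelfConjugate T hL hself hc
  have hfin := hL.finiteDimensional
  have hw := SymRep.reflection_mul_self T hsymm
  have hFS := SymRep.sum_character_sq hirr
    (SymRep.isSemiInvariant_pullbackForm (χ := 1) hL.map_rho 1)
    (hL.pullbackForm_ne_zero (mul_one 1) (SymRep.adjoint_one_youngSymmetrizer T)
      (SymRep.youngSymmetrizer_mul_ne_zero T)) _ (SymRep.pullbackForm_flip (mul_one 1))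
  have htFS := SymRep.sum_character_sq hirr
    (SymRep.isSemiInvariant_pullbackForm (χ := SymRep.signChar d) hL.map_rho _)
    (hL.pullbackForm_ne_zero hw (SymRep.adjoint_signChar_youngSymmetrizer T hsymm)
      (SymRep.youngSymmetrizer_mul_self_ne_zero T)) _ (SymRep.pullbackForm_flip hw)
  rw [SymRep.signChar_reflection, Fintype.card_perm, Fintype.card_fin] at htFS
  rw [Fintype.card_perm, Fintype.card_fin] at hFS
  simp only [MonoidHom.one_apply, inv_one, Units.val_one, one_mul] at hFS
  have ho := SymRep.factorial_mul_o ρ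
  have hd : (d.factorial : ℂ) ≠ 0 := Nat.cast_ne_zero.2 d.factorial_ne_zero
  set s : ℂ := (-1) ^ ((d - SymRep.rank μ) / 2) with hs
  -- The weight `1 - sgn(g)` is `2` on odd permutations and `0` on even ones.
  have h2 : 2 * SymRep.o ρ = 1 - s := by
    refine mul_left_cancel₀ hd ?_
    calc (d.factorial : ℂ) * (2 * SymRep.o ρ)
        = 2 * ∑ g : Equiv.Perm (Fin d) with Equiv.Perm.sign g = -1, ρ.character (g ^ 2) := by
          rw [← ho]; ring
      _ = ∑ g : Equiv.Perm (Fin d), (ρ.character (g ^ 2)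
            - ((SymRep.signChar d g)⁻¹ : ℂˣ).val * ρ.character (g ^ 2)) := by
          rw [Finset.sum_filter, Finset.mul_sum]
          refine Finset.sum_congr rfl fun g _ => ?_
          rw [Units.val_inv_eq_inv_val, SymRep.signChar_apply]
          rcases Int.units_eq_one_or (Equiv.Perm.sign g) with h | h
          · rw [h, if_neg (by decide)]
            simp
          · rw [h, if_pos rfl]
            push_cast
            ring
      _ = (d.factorial : ℂ) * (1 - s) := by
          rw [Finset.sum_sub_distrib, hFS, htFS]
          ring
  have hs' : s = 1 ∨ s = -1 := neg_one_pow_eq_or ℂ _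
  have hr := SymRep.rank_le_and_even T hsymm
  rcases hs' with h | h
  · have ho0 : SymRep.o ρ = 0 := by
      rw [h, sub_self] at h2
      simpa using h2
    -- `epsilon` is a complex power, so it is evaluated only after `o ρ` is known to be `0` or `1`.
    exact ⟨Or.inl ho0, hr.1, hr.2, by rw [SymRep.epsilon, ho0, h, Complex.cpow_zero]⟩
  · have ho1 : SymRep.o ρ = 1 := by
      rw [h] at h2
      linear_combination h2 / 2
    exact ⟨Or.inr ho1, hr.1, hr.2, by rw [SymRep.epsilon, ho1, h, Complex.cpow_one]⟩
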